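/- Let $X$ be a dendrite, i.e. a nonempty compact connected metric space that is locally connected and has no subspace homeomorphic to the circle $S^1$, and let $f\colon X\to X$ be continuous. For $x\in X$ let $\omega(x,f)$ be the set of all $y\in X$ for which there is a strictly increasing sequence $(n_i)$ of positive integers with $f^{n_i}(x)\to y$, and let $\Omega(x,f)$ be the set of all $y\in X$ for which there are a sequence $(x_i)$ in $X$ with $x_i\to x$ and a strictly increasing sequence $(n_i)$ of positive integers with $f^{n_i}(x_i)\to y$. Suppose that $\omega(x,f)=\Omega(x,f)$ for every $x\in X$. Then for every integer $m\ge 1$ the set $\mathrm{Fix}(f^m)=\{x\in X: f^m(x)=x\}$ is nonempty and connected. Moreover, the set $\mathrm{Per}(f)=\bigcup_{m\ge 1}\mathrm{Fix}(f^m)$ of periodic points of $f$ is nonempty and connected. -/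

import Mathlib

open Filter Topology

/-- A continuum: a nonempty, compact, connected metric space
(`ConnectedSpace` includes nonemptiness). -/
structure IsContinuum (X : Type*) [MetricSpace X] : Prop where
  compact : CompactSpace X
  connected : ConnectedSpace X

/-- A dendrite: a locally connected continuum no subspace of which is homeomorphic to the
unit circle. -/
structure IsDendrite (X : Type*) [MetricSpace X] : Prop where
  continuum : IsContinuum X
  locallyConnected : LocallyConnectedSpace X
  no_simple_closed_curve : ∀ S : Set X, ¬ Nonempty (S ≃ₜ Circle)

/-- `ω(x, f)`: the limits of `f^[n i] x` along strictly increasing sequences `n`. -/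
def omegaSet {X : Type*} [TopologicalSpace X] (x : X) (f : X → X) : Set X :=
  {y | ∃ n : ℕ → ℕ, StrictMono n ∧ Tendsto (fun i => f^[n i] x) atTop (𝓝 y)}

/-- `Ω(x, f)`: the limits of `f^[n i] (u i)` along sequences `u` converging to `x` and strictly
increasing sequences `n`. -/
def bigOmegaSet {X : Type*} [TopologicalSpace X] (x : X) (f : X → X) : Set X :=
  {y | ∃ (u : ℕ → X) (n : ℕ → ℕ), Tendsto u atTop (𝓝 x) ∧ StrictMono n ∧
    Tendsto (fun i => f^[n i] (u i)) atTop (𝓝 y)}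

/-! In a dendrite the hull `[a, b]` = `continuumHull a b` of two distinct points is an arc: open
connected sets are path connected, a path between distinct points contains an arc, and a second arc
not covering the first would produce a circle. For fixed `c`, the relation `y ∈ [c, z]` is therefore
a closed partial order, and `[a, b] ⊆ [a, c] ∪ [c, b]`. These facts carry all later arguments.

A maximal `y` with `y ∈ [c, f y]` is fixed, since otherwise it could be pushed towards `f y`. The
equality of `ω` and `Ω` makes periodic points Lyapunov stable (`exists_nhds_iterate_mem`): orbits
starting ever closer to `p` but meeting a closed set off the orbit of `p` would put a point of that
set in `Ω(p, f)`, whereas `ω(p, f)` lies in the finite orbit. So the fixed points of `g = f^m` have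
arbitrarily small closed connected invariant neighbourhoods.

Stability forbids motion away from a fixed point: if `a` is fixed and `x ∈ [a, g x]`, then `g x = x`
(`IsDendrite.eq_of_mem_continuumHull`). For `a`, `b` fixed and `x ∈ [a, b]`, either `x ∈ [a, g x]`
or `x ∈ [g x, b]`, so `x` is fixed. Thus `Fix(g)` contains the hull of any two of its points. The
sets `Fix(f^m)` all share a fixed point of `f`, so their union is connected. -/

/-! ### Local path connectedness by refinement of chains. -/

/-- Two points are `ε`-linked if some open connected set of diameter at most `ε` contains both. -/
def SmallLink {X : Type*} [MetricSpace X] (ε : ℝ) (x y : X) : Prop :=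
  ∃ W : Set X, IsOpen W ∧ IsPreconnected W ∧ x ∈ W ∧ y ∈ W ∧ ∀ u ∈ W, ∀ v ∈ W, dist u v ≤ ε

theorem SmallLink.dist_le {X : Type*} [MetricSpace X] {ε : ℝ} {x y : X} (h : SmallLink ε x y) :
    dist x y ≤ ε := by
  obtain ⟨W, -, -, hx, hy, h⟩ := h
  exact h x hx y hy

theorem SmallLink.symm {X : Type*} [MetricSpace X] {ε : ℝ} {x y : X} (h : SmallLink ε x y) :
    SmallLink ε y x := by
  obtain ⟨W, ho, hc, hx, hy, h⟩ := h
  exact ⟨W, ho, hc, hy, hx, h⟩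

theorem exists_open_preconnected_subset {X : Type*} [TopologicalSpace X] [LocallyConnectedSpace X]
    {x : X} {V : Set X} (hV : V ∈ 𝓝 x) : ∃ W ⊆ V, IsOpen W ∧ IsPreconnected W ∧ x ∈ W := by
  obtain ⟨W, hW, h⟩ := locallyConnectedSpace_iff_subsets_isOpen_isConnected.1 ‹_› x V hV
  exact ⟨W, hW, h.1, h.2.2.isPreconnected, h.2.1⟩

theorem eventually_smallLink {X : Type*} [MetricSpace X] [LocallyConnectedSpace X] {ε : ℝ}
    (hε : 0 < ε) (x : X) : ∀ᶠ y in 𝓝 x, SmallLink ε x y := by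
  obtain ⟨W, hW, ho, hc, hx⟩ := exists_open_preconnected_subset
    (Metric.ball_mem_nhds x (half_pos hε))
  filter_upwards [ho.mem_nhds hx] with y hy
  refine ⟨W, ho, hc, hx, hy, fun u hu v hv => ?_⟩
  have h1 := hW hu
  have h2 := hW hv
  rw [Metric.mem_ball] at h1 h2
  linarith [dist_triangle_right u v x]

theorem smallLink_self {X : Type*} [MetricSpace X] [LocallyConnectedSpace X] {ε : ℝ}
    (hε : 0 < ε) (x : X) : SmallLink ε x x :=
  (eventually_smallLink hε x).self_of_nhds

/-- A link can be replaced by a chain of arbitrarily small links. -/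
theorem SmallLink.exists_chain {X : Type*} [MetricSpace X] [LocallyConnectedSpace X]
    {ε η : ℝ} (hη : 0 < η) {x y : X} (h : SmallLink ε x y) :
    ∃ k : ℕ, ∃ c : ℕ → X, c 0 = x ∧ (∀ j ≥ k, c j = y) ∧
      (∀ j, SmallLink η (c j) (c (j + 1))) ∧ ∀ j, dist x (c j) ≤ ε := by
  obtain ⟨W, ho, hc, hx, hy, hW⟩ := h
  let P : X → X → Prop := fun x y => ∃ k : ℕ, ∃ c : ℕ → X, c 0 = x ∧ (∀ j ≥ k, c j = y) ∧
      (∀ j, SmallLink η (c j) (c (j + 1))) ∧ ∀ j, c j ∈ W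
  have hP : ∀ {x y}, x ∈ W → y ∈ W → P x y := by
    intro x y hx hy
    -- Being joined by a chain inside `W` is transitive and holds locally in both directions, so it
    -- holds throughout the preconnected set `W`.
    refine hc.induction₂' P ?_ ?_ hx hy
    · have key : ∀ x ∈ W, ∀ y ∈ W, SmallLink η x y → P x y := by
        intro x hx y hy hl
        refine ⟨1, fun j => if j = 0 then x else y, by simp, fun j hj => ?_, fun j => ?_, fun j => ?_⟩
        · have : j ≠ 0 := by omega
          simp [this]
        · by_cases hj : j = 0
          · simpa [hj] using hl
          · simpa [hj] using smallLink_self hη y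
        · by_cases hj : j = 0 <;> simp [hj, hx, hy]
      intro x hx
      filter_upwards [mem_nhdsWithin_of_mem_nhds (eventually_smallLink hη x),
        self_mem_nhdsWithin] with y hl hy
      exact ⟨key x hx y hy hl, key y hy x hx hl.symm⟩
    · rintro x y z - - - ⟨k, c, h0, hk, hl, hw⟩ ⟨k', c', h0', hk', hl', hw'⟩
      refine ⟨k + k', fun j => if j < k then c j else c' (j - k), ?_, fun j hj => ?_, fun j => ?_,
        fun j => ?_⟩
      · by_cases h : 0 < k
        · simp [h, h0]
        · have : k = 0 := by omega
          simp [this, h0', ← h0, hk 0 (by omega)]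
      · have : ¬ j < k := by omega
        simp only [this, if_false]
        exact hk' _ (by omega)
      · by_cases h : j + 1 < k
        · simpa [h, show j < k by omega] using hl j
        · by_cases h' : j < k
          · have e : j + 1 - k = 0 := by omega
            simp only [h, h', if_true, if_false, e, h0']
            rw [← hk (j + 1) (by omega)]
            exact hl j
          · have e : j + 1 - k = (j - k) + 1 := by omega
            simp only [h, h', if_false, e]
            exact hl' _
      · dsimp only
        split_ifs
        exacts [hw _, hw' _]
  obtain ⟨k, c, h0, hk, hl, hw⟩ := hP hx hy
  exact ⟨k, c, h0, hk, hl, fun j => hW _ hx _ (hw j)⟩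

/-- A sequence of `ε`-linked points from `x` to `y`, reaching `y` after `N` steps. -/
structure IsLinkChain {X : Type*} [MetricSpace X] (ε : ℝ) (x y : X) (N : ℕ) (z : ℕ → X) :
    Prop where
  pos : 0 < N
  start : z 0 = x
  finish : ∀ i ≥ N, z i = y
  link : ∀ i, SmallLink ε (z i) (z (i + 1))

/-- All links are subdivided into the same number `K` of pieces, by padding short chains with their
last point. New index `m` then belongs to old link `m / K`, which keeps uniform parametrizations of
successive chains compatible. -/
theorem IsLinkChain.refine {X : Type*} [MetricSpace X] [LocallyConnectedSpace X]
    {ε η : ℝ} (hε : 0 ≤ ε) (hη : 0 < η) {x y : X} {N : ℕ} {z : ℕ → X}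
    (h : IsLinkChain ε x y N z) :
    ∃ K : ℕ, 0 < K ∧ ∃ z', IsLinkChain η x y (N * K) z' ∧ ∀ m, dist (z (m / K)) (z' m) ≤ ε := by
  let P : ℕ → ℕ → (ℕ → X) → Prop := fun i k c => c 0 = z i ∧ (∀ j ≥ k, c j = z (i + 1)) ∧
      (∀ j, SmallLink η (c j) (c (j + 1))) ∧ ∀ j, dist (z i) (c j) ≤ ε
  have h1 : ∀ i, ∃ k c, P i k c := fun i => (h.link i).exists_chain hη
  choose k c hk using h1
  obtain ⟨K, hKpos, hK⟩ : ∃ K, 0 < K ∧ ∀ i < N, k i ≤ K := by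
    refine ⟨(Finset.range N).sup k + 1, by omega, fun i hi => ?_⟩
    exact (Finset.le_sup (f := k) (Finset.mem_range.2 hi)).trans (by omega)
  have h2 : ∀ i, ∃ c, P i K c ∧ (N ≤ i → ∀ j, c j = y) := by
    intro i
    by_cases hi : i < N
    · exact ⟨c i, ⟨(hk i).1, fun j hj => (hk i).2.1 j ((hK i hi).trans hj), (hk i).2.2⟩,
        fun h => absurd hi (not_lt.2 h)⟩
    · have e1 := h.finish i (by omega)
      have e2 := h.finish (i + 1) (by omega)
      exact ⟨fun _ => y, ⟨e1.symm, fun _ _ => e2.symm, fun _ => smallLink_self hη y,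
        fun _ => by simpa [e1] using hε⟩, fun _ _ => rfl⟩
  choose d hd hdy using h2
  refine ⟨K, hKpos, fun m => d (m / K) (m % K), ⟨Nat.mul_pos h.pos hKpos, ?_, ?_, ?_⟩, ?_⟩
  · simp [(hd 0).1, h.start]
  · exact fun i hi => hdy _ ((Nat.le_div_iff_mul_le hKpos).2 hi) _
  · intro i
    have hlt := Nat.mod_lt i hKpos
    have hdm := Nat.div_add_mod i K
    by_cases hc : i % K + 1 < K
    · have e1 : (i + 1) / K = i / K :=
        Nat.div_eq_of_lt_le (by rw [mul_comm]; omega) (by rw [Nat.add_mul, mul_comm]; omega)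
      have e2 : (i + 1) % K = i % K + 1 := by
        have := Nat.div_add_mod (i + 1) K
        rw [e1] at this
        omega
      rw [e1, e2]
      exact (hd _).2.2.1 _
    · have e : i + 1 = K * (i / K + 1) := by rw [Nat.mul_add]; omega
      have e1 : (i + 1) / K = i / K + 1 := by rw [e, Nat.mul_div_cancel_left _ hKpos]
      have e2 : (i + 1) % K = 0 := by rw [e, Nat.mul_mod_right]
      rw [e1, e2, (hd _).1, ← (hd (i / K)).2.1 (i % K + 1) (by omega)]
      exact (hd _).2.2.1 _
  · intro m
    exact (hd _).2.2.2 _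

/-- Chains of ever smaller links, each refining the one before, converge to a path. -/
theorem SmallLink.exists_path {X : Type*} [MetricSpace X] [CompleteSpace X]
    [LocallyConnectedSpace X] {ε : ℝ} (hε : 0 < ε) {x y : X} (h : SmallLink ε x y) :
    ∃ g : ℝ → X, ContinuousOn g (Set.Icc 0 1) ∧ g 0 = x ∧ g 1 = y ∧
      ∀ t ∈ Set.Icc (0 : ℝ) 1, dist x (g t) ≤ 3 * ε := by
  let e : ℕ → ℝ := fun n => ε / 2 ^ n
  have he : ∀ n, 0 < e n := fun n => by positivity
  let Q : ℕ → Type _ := fun n => {p : ℕ × (ℕ → X) // IsLinkChain (e n) x y p.1 p.2}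
  have step : ∀ n (p : Q n), ∃ q : Q (n + 1), ∃ K : ℕ, 0 < K ∧ q.1.1 = p.1.1 * K ∧
      ∀ m, dist (p.1.2 (m / K)) (q.1.2 m) ≤ e n := by
    intro n p
    obtain ⟨K, hK, z, hz, hd⟩ := p.2.refine (he n).le (he (n + 1))
    exact ⟨⟨(_, z), hz⟩, K, hK, rfl, hd⟩
  choose next K hK hN hd using step
  have base : IsLinkChain (e 0) x y 1 (fun j => if j = 0 then x else y) := by
    refine ⟨one_pos, by simp, fun i hi => ?_, fun i => ?_⟩
    · simp [show i ≠ 0 by omega]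
    · by_cases hi : i = 0
      · simpa [hi, e] using h
      · simpa [hi] using smallLink_self (he 0) y
  let s : ∀ n, Q n := fun n => Nat.rec ⟨(1, fun j => if j = 0 then x else y), base⟩ next n
  let N : ℕ → ℕ := fun n => (s n).1.1
  let z : ℕ → ℕ → X := fun n => (s n).1.2
  have hz : ∀ n, IsLinkChain (e n) x y (N n) (z n) := fun n => (s n).2
  -- The `n`-th chain run through at uniform speed on `[0, 1]`; the path is the limit of these step
  -- functions.
  let G : ℕ → ℝ → X := fun n t => z n ⌊t * N n⌋₊
  have hGG : ∀ t n, dist (G n t) (G (n + 1) t) ≤ 2 * ε / 2 / 2 ^ n := by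
    intro t n
    have hKn := hK n (s n)
    have h1 : ⌊t * N n⌋₊ = ⌊t * N (n + 1)⌋₊ / K n (s n) := by
      rw [← Nat.floor_div_natCast]
      congr 1
      have : N (n + 1) = N n * K n (s n) := hN n (s n)
      rw [this]
      push_cast
      field_simp
    have := hd n (s n) ⌊t * N (n + 1)⌋₊
    rw [← h1] at this
    rw [mul_div_cancel_left₀ _ two_ne_zero]
    exact this
  have hlim : ∀ t, ∃ a, Tendsto (fun n => G n t) atTop (𝓝 a) := fun t =>
    cauchySeq_tendsto_of_complete (cauchySeq_of_le_geometric_two (hGG t))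
  choose g hg using hlim
  have hGg : ∀ t n, dist (G n t) (g t) ≤ 2 * e n := fun t n => by
    have := dist_le_of_le_geometric_two_of_tendsto (hGG t) (hg t) n
    rwa [mul_div_assoc] at this
  -- The constant is `2 + 1 + 2`: two distances from the limit to the `n`-th chain, and one link.
  have osc : ∀ (n : ℕ) (s t : ℝ), 0 ≤ s → s ≤ t → t - s < 1 / N n → dist (g s) (g t) ≤ 5 * e n := by
    intro n s t h0 hst h1
    have hNpos : (0 : ℝ) < N n := by exact_mod_cast (hz n).pos
    have h2 : t * N n ≤ s * N n + 1 := by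
      rw [lt_div_iff₀ hNpos] at h1
      linarith
    have h3 : ⌊t * N n⌋₊ ≤ ⌊s * N n⌋₊ + 1 := by
      rw [← Nat.floor_add_one (by positivity)]
      exact Nat.floor_le_floor h2
    have h4 : ⌊s * N n⌋₊ ≤ ⌊t * N n⌋₊ := Nat.floor_le_floor (by gcongr)
    have h5 : dist (G n s) (G n t) ≤ e n := by
      rcases (show ⌊t * N n⌋₊ = ⌊s * N n⌋₊ ∨ ⌊t * N n⌋₊ = ⌊s * N n⌋₊ + 1 by omega) with h | h
      · simp [G, h, (he n).le]
      · simp only [G, h]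
        exact ((hz n).link _).dist_le
    have h6 := hGg s n
    have h7 := hGg t n
    rw [dist_comm] at h6
    linarith [dist_triangle4 (g s) (G n s) (G n t) (g t)]
  refine ⟨g, ?_, ?_, ?_, ?_⟩
  · refine Metric.continuousOn_iff.2 fun t ht δ hδ => ?_
    obtain ⟨n, hn⟩ : ∃ n, 5 * e n < δ := by
      obtain ⟨n, hn⟩ := exists_pow_lt_of_lt_one (show 0 < δ / (5 * ε) by positivity)
        (show (1 / 2 : ℝ) < 1 by norm_num)
      refine ⟨n, ?_⟩
      rw [lt_div_iff₀ (by positivity), one_div, inv_pow] at hn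
      calc 5 * e n = (2 ^ n)⁻¹ * (5 * ε) := by simp only [e]; ring
        _ < δ := hn
    have hNpos : (0 : ℝ) < N n := by exact_mod_cast (hz n).pos
    refine ⟨1 / N n, by positivity, fun u hu hut => ?_⟩
    rw [Real.dist_eq, abs_lt] at hut
    rcases le_total u t with hle | hle
    · exact (osc n u t hu.1 hle (by linarith)).trans_lt hn
    · rw [dist_comm]
      exact (osc n t u ht.1 hle (by linarith)).trans_lt hn
  · refine tendsto_nhds_unique (hg 0) ?_
    simp [G, (hz _).start]
  · refine tendsto_nhds_unique (hg 1) ?_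
    simp [G, (hz _).finish]
  · intro t _
    have h1 := hGg t 0
    have h2 : dist x (G 0 t) ≤ ε := by
      have h3 : G 0 t = if ⌊t * N 0⌋₊ = 0 then x else y := rfl
      rw [h3]
      split_ifs
      · simpa using hε.le
      · exact h.dist_le
    have h4 : e 0 = ε := by simp [e]
    rw [h4] at h1
    linarith [dist_triangle x (G 0 t) (g t)]

/-- Complete locally connected metric spaces are locally path connected. -/
theorem locallyPathConnectedSpace_of_complete {X : Type*} [MetricSpace X] [CompleteSpace X]
    [LocallyConnectedSpace X] : LocallyPathConnectedSpace X := by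
  rw [locallyPathConnectedSpace_iff_pathComponentIn_mem_nhds]
  intro x U hU hx
  obtain ⟨ε, hε, hb⟩ := Metric.isOpen_iff.1 hU x hx
  filter_upwards [eventually_smallLink (show 0 < ε / 4 by positivity) x] with y hy
  obtain ⟨g, hg, h0, h1, hd⟩ := hy.exists_path (by positivity)
  refine ⟨⟨⟨fun t => g t, hg.comp_continuous continuous_subtype_val fun t => t.2⟩,
    by simpa using h0, by simpa using h1⟩, fun t => hb ?_⟩
  rw [Metric.mem_ball, dist_comm]
  exact (hd t t.2).trans_lt (by linarith)

/-! ### Extraction of an arc from a path. -/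

/-- A closed subset of `[0, 1]` containing the endpoints across the gaps of which
`γ` takes equal values. -/
def IsGapSet {X : Type*} (γ : ℝ → X) (F : Set ℝ) : Prop :=
  F ⊆ Set.Icc 0 1 ∧ IsClosed F ∧ 0 ∈ F ∧ 1 ∈ F ∧
    ∀ s ∈ F, ∀ t ∈ F, s < t → F ∩ Set.Ioo s t = ∅ → γ s = γ t

theorem exists_isGreatest_inter_Icc {F : Set ℝ} (hF : IsClosed F) {a b x : ℝ} (hx : x ∈ F)
    (hxab : x ∈ Set.Icc a b) : ∃ s, IsGreatest (F ∩ Set.Icc a b) s :=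
  (isCompact_Icc.inter_left hF).exists_isGreatest ⟨x, hx, hxab⟩

theorem exists_isLeast_inter_Icc {F : Set ℝ} (hF : IsClosed F) {a b x : ℝ} (hx : x ∈ F)
    (hxab : x ∈ Set.Icc a b) : ∃ s, IsLeast (F ∩ Set.Icc a b) s :=
  (isCompact_Icc.inter_left hF).exists_isLeast ⟨x, hx, hxab⟩

/-- For Zorn's lemma, a gap of the intersection of a chain is approximated by gaps of its members,
and continuity of `γ` carries equality of the end values to the limit. -/
theorem exists_minimal_isGapSet {X : Type*} [MetricSpace X] {γ : ℝ → X}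
    (hγ : ContinuousOn γ (Set.Icc 0 1)) : ∃ F, Minimal (IsGapSet γ) F := by
  refine zorn_superset {F | IsGapSet γ F} fun c hc hchain => ?_
  rcases c.eq_empty_or_nonempty with rfl | hne
  · refine ⟨Set.Icc 0 1, ⟨subset_rfl, isClosed_Icc, by simp, by simp, fun s hs t ht hst h => ?_⟩,
      by simp⟩
    have : (s + t) / 2 ∈ Set.Icc (0 : ℝ) 1 ∩ Set.Ioo s t :=
      ⟨⟨by linarith [hs.1, ht.1], by linarith [hs.2, ht.2]⟩, by linarith, by linarith⟩
    rw [h] at this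
    exact this.elim
  · have hsub : ⋂₀ c ⊆ Set.Icc 0 1 := by
      obtain ⟨F, hF⟩ := hne
      exact (Set.sInter_subset_of_mem hF).trans (hc hF).1
    refine ⟨⋂₀ c, ⟨hsub, isClosed_sInter fun F hF => (hc hF).2.1,
      fun F hF => (hc hF).2.2.1, fun F hF => (hc hF).2.2.2.1, ?_⟩,
      fun F hF => Set.sInter_subset_of_mem hF⟩
    intro s hs t ht hst hgap
    refine eq_of_forall_dist_le fun ε hε => ?_
    have hs1 := hsub hs
    have ht1 := hsub ht
    obtain ⟨η, hη, hs2⟩ := Metric.continuousOn_iff.1 hγ s hs1 (ε / 2) (half_pos hε)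
    obtain ⟨η', hη', ht2⟩ := Metric.continuousOn_iff.1 hγ t ht1 (ε / 2) (half_pos hε)
    obtain ⟨r, hr, hr1, hr2, hr3⟩ : ∃ r > 0, r < η ∧ r < η' ∧ 2 * r < t - s := by
      refine ⟨min (min η η') (t - s) / 3, ?_, ?_, ?_, ?_⟩
      · have : 0 < min (min η η') (t - s) := lt_min (lt_min hη hη') (by linarith)
        linarith
      all_goals
        have h1 := min_le_left (min η η') (t - s)
        have h2 := min_le_right (min η η') (t - s)
        have h3 := min_le_left η η'
        have h4 := min_le_right η η'
        have : 0 < min (min η η') (t - s) := lt_min (lt_min hη hη') (by linarith)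
        linarith
    -- By compactness a single member of the chain already misses the slightly shrunken gap.
    obtain ⟨F, hF, hFr⟩ : ∃ F ∈ c, F ∩ Set.Icc (s + r) (t - r) = ∅ := by
      by_contra! hcon
      have : Nonempty c := hne.to_subtype
      have : (⋂ F : c, (F : Set ℝ) ∩ Set.Icc (s + r) (t - r)).Nonempty := by
        refine IsCompact.nonempty_iInter_of_directed_nonempty_isCompact_isClosed _ ?_
          (fun F => hcon F F.2)
          (fun F => isCompact_Icc.inter_left (hc F.2).2.1)
          (fun F => (hc F.2).2.1.inter isClosed_Icc)
        intro F G
        rcases hchain.total F.2 G.2 with h | h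
        · exact ⟨F, subset_rfl, Set.inter_subset_inter_left _ h⟩
        · exact ⟨G, Set.inter_subset_inter_left _ h, subset_rfl⟩
      obtain ⟨x, hx⟩ := this
      rw [Set.mem_iInter] at hx
      obtain ⟨F0, hF0⟩ := hne
      have hx0 := (hx ⟨F0, hF0⟩).2
      have : x ∈ ⋂₀ c ∩ Set.Ioo s t :=
        ⟨fun F hF => (hx ⟨F, hF⟩).1, by linarith [hx0.1], by linarith [hx0.2]⟩
      rw [hgap] at this
      exact this.elim
    have hFs := hs F hF
    have hFt := ht F hF
    obtain ⟨s', ⟨hs'F, hs'⟩, hs'max⟩ := exists_isGreatest_inter_Icc (hc hF).2.1 hFs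
      (show s ∈ Set.Icc s (s + r) from ⟨le_rfl, by linarith⟩)
    obtain ⟨t', ⟨ht'F, ht'⟩, ht'min⟩ := exists_isLeast_inter_Icc (hc hF).2.1 hFt
      (show t ∈ Set.Icc (t - r) t from ⟨by linarith, le_rfl⟩)
    have heq : γ s' = γ t' := by
      refine (hc hF).2.2.2.2 s' hs'F t' ht'F (by linarith [hs'.2, ht'.1]) ?_
      refine Set.eq_empty_of_forall_notMem fun x ⟨hxF, hx1, hx2⟩ => ?_
      rcases le_total x (s + r) with h | h
      · exact hx1.not_ge (hs'max ⟨hxF, by linarith [hs'.1], h⟩)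
      · rcases le_total (t - r) x with h' | h'
        · exact hx2.not_ge (ht'min ⟨hxF, h', by linarith [ht'.2]⟩)
        · exact Set.eq_empty_iff_forall_notMem.1 hFr x ⟨hxF, h, h'⟩
    have e1 := hs2 s' ((hc hF).1 hs'F) (by rw [Real.dist_eq, abs_lt]; constructor <;> linarith [hs'.1, hs'.2])
    have e2 := ht2 t' ((hc hF).1 ht'F) (by rw [Real.dist_eq, abs_lt]; constructor <;> linarith [ht'.1, ht'.2])
    rw [dist_comm] at e1
    rw [← heq] at e2
    linarith [dist_triangle (γ s) (γ s') (γ t)]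

/-- A path may be modified to a path with the same endpoints all of whose fibres are
order convex. -/
theorem exists_path_ordConnected_fibres {X : Type*} [MetricSpace X] {γ : ℝ → X}
    (hγ : ContinuousOn γ (Set.Icc 0 1)) :
    ∃ δ : ℝ → X, ContinuousOn δ (Set.Icc 0 1) ∧ δ 0 = γ 0 ∧ δ 1 = γ 1 ∧
      δ '' Set.Icc 0 1 ⊆ γ '' Set.Icc 0 1 ∧
      ∀ s ∈ Set.Icc (0 : ℝ) 1, ∀ t ∈ Set.Icc (0 : ℝ) 1, δ s = δ t →
        ∀ u ∈ Set.Icc s t, δ u = δ s := by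
  obtain ⟨F, ⟨hF, hclosed, h0, h1, hgap⟩, hmin⟩ := exists_minimal_isGapSet hγ
  -- Cutting `(s, t)` out of `F` leaves a gap set, so by minimality nothing was there to cut.
  have hcollapse : ∀ s ∈ F, ∀ t ∈ F, s < t → γ s = γ t → F ∩ Set.Ioo s t = ∅ := by
    intro s hs t ht hst heq
    have hG : IsGapSet γ (F \ Set.Ioo s t) := by
      refine ⟨Set.sdiff_subset.trans hF, hclosed.sdiff isOpen_Ioo,
        ⟨h0, fun h => h.1.not_ge (hF hs).1⟩, ⟨h1, fun h => h.2.not_ge (hF ht).2⟩, ?_⟩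
      rintro u ⟨hu, hu'⟩ v ⟨hv, hv'⟩ huv hempty
      by_cases hF' : F ∩ Set.Ioo u v = ∅
      · exact hgap u hu v hv huv hF'
      obtain ⟨w, hw, hw1, hw2⟩ := Set.nonempty_iff_ne_empty.2 hF'
      have hwst : w ∈ Set.Ioo s t := by
        by_contra hcon
        exact Set.eq_empty_iff_forall_notMem.1 hempty w ⟨⟨hw, hcon⟩, hw1, hw2⟩
      have hus : u ≤ s := by
        by_contra! hcon
        exact hu' ⟨hcon, hw1.trans hwst.2⟩
      have htv : t ≤ v := by
        by_contra! hcon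
        exact hv' ⟨hwst.1.trans hw2, hcon⟩
      have hus' : u = s := by
        by_contra hne
        exact Set.eq_empty_iff_forall_notMem.1 hempty s
          ⟨⟨hs, fun h => h.1.false⟩, lt_of_le_of_ne hus hne, hst.trans_le htv⟩
      have htv' : t = v := by
        by_contra hne
        exact Set.eq_empty_iff_forall_notMem.1 hempty t
          ⟨⟨ht, fun h => h.2.false⟩, hus.trans_lt hst, lt_of_le_of_ne htv hne⟩
      rw [hus', ← htv', heq]
    refine Set.eq_empty_of_forall_notMem fun x hx => ?_
    exact (hmin hG Set.sdiff_subset hx.1).2 hx.2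
  -- The new path is `γ ∘ σ`, where `σ t` is the last point of `F` up to `t`; it is constant across
  -- gaps.
  have hσ : ∀ t, ∃ s, t ∈ Set.Icc (0 : ℝ) 1 → IsGreatest (F ∩ Set.Icc 0 t) s := by
    intro t
    by_cases ht : t ∈ Set.Icc (0 : ℝ) 1
    · obtain ⟨s, hs⟩ := exists_isGreatest_inter_Icc hclosed h0
        (show (0 : ℝ) ∈ Set.Icc 0 t from ⟨le_rfl, ht.1⟩)
      exact ⟨s, fun _ => hs⟩
    · exact ⟨0, fun h => absurd h ht⟩
  choose σ hσ using hσ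
  have hσF : ∀ t ∈ F, σ t = t := fun t ht =>
    le_antisymm (hσ t (hF ht)).1.2.2 ((hσ t (hF ht)).2 ⟨ht, (hF ht).1, le_rfl⟩)
  -- Both values agree or are attained by `γ` at points of `F` between `s` and `t`, so `γ ∘ σ`
  -- inherits the modulus of continuity of `γ`.
  have hbetween : ∀ s ∈ Set.Icc (0 : ℝ) 1, ∀ t ∈ Set.Icc (0 : ℝ) 1, s ≤ t →
      γ (σ s) = γ (σ t) ∨ ∃ s' ∈ F ∩ Set.Icc s t, ∃ t' ∈ F ∩ Set.Icc s t,
        γ (σ s) = γ s' ∧ γ (σ t) = γ t' := by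
    intro s hs t ht hst
    rcases lt_or_ge (σ t) s with h | h
    · left
      congr 1
      exact le_antisymm ((hσ t ht).2 ⟨(hσ s hs).1.1, (hσ s hs).1.2.1, (hσ s hs).1.2.2.trans hst⟩)
        ((hσ s hs).2 ⟨(hσ t ht).1.1, (hσ t ht).1.2.1, h.le⟩)
    · right
      have hmem : σ t ∈ Set.Icc s t := ⟨h, (hσ t ht).1.2.2⟩
      obtain ⟨s', hs', hs'min⟩ := exists_isLeast_inter_Icc hclosed (hσ t ht).1.1 hmem
      refine ⟨s', hs', σ t, ⟨(hσ t ht).1.1, hmem⟩, ?_, rfl⟩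
      rcases eq_or_lt_of_le ((hσ s hs).1.2.2.trans hs'.2.1) with he | hlt
      · rw [he]
      · refine hgap _ (hσ s hs).1.1 _ hs'.1 hlt (Set.eq_empty_of_forall_notMem fun x hx => ?_)
        rcases le_total x s with hxs | hxs
        · exact hx.2.1.not_ge ((hσ s hs).2 ⟨hx.1, (hF hx.1).1, hxs⟩)
        · exact hx.2.2.not_ge (hs'min ⟨hx.1, hxs, hx.2.2.le.trans hs'.2.2⟩)
  refine ⟨fun t => γ (σ t), ?_, by simp [hσF 0 h0], by simp [hσF 1 h1], ?_, ?_⟩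
  · have hu : UniformContinuousOn γ (Set.Icc 0 1) :=
      isCompact_Icc.uniformContinuousOn_of_continuous hγ
    refine UniformContinuousOn.continuousOn (Metric.uniformContinuousOn_iff.2 fun ε hε => ?_)
    obtain ⟨η, hη, h⟩ := Metric.uniformContinuousOn_iff.1 hu ε hε
    refine ⟨η, hη, fun s hs t ht hst => ?_⟩
    wlog hle : s ≤ t generalizing s t
    · rw [dist_comm]
      exact this t ht s hs (by rwa [dist_comm]) (le_of_not_ge hle)
    rcases hbetween s hs t ht hle with he | ⟨s', hs', t', ht', e1, e2⟩
    · simpa [he] using hε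
    · rw [e1, e2]
      refine h s' (hF hs'.1) t' (hF ht'.1) (lt_of_le_of_lt ?_ hst)
      exact Real.dist_le_of_mem_Icc hs'.2 ht'.2 |>.trans
        (by rw [dist_comm, Real.dist_eq]; exact le_abs_self _)
  · rintro _ ⟨t, ht, rfl⟩
    exact ⟨σ t, hF (hσ t ht).1.1, rfl⟩
  · intro s hs t ht heq u hu
    have hu1 : u ∈ Set.Icc (0 : ℝ) 1 := ⟨hs.1.trans hu.1, hu.2.trans ht.2⟩
    have hsu : σ s ≤ σ u := (hσ u hu1).2 ⟨(hσ s hs).1.1, (hσ s hs).1.2.1,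
      (hσ s hs).1.2.2.trans hu.1⟩
    have hut : σ u ≤ σ t := (hσ t ht).2 ⟨(hσ u hu1).1.1, (hσ u hu1).1.2.1,
      (hσ u hu1).1.2.2.trans hu.2⟩
    rcases eq_or_lt_of_le hsu with he | hlt
    · simp [he]
    rcases eq_or_lt_of_le hut with he | hlt'
    · simp [he, heq]
    have := hcollapse _ (hσ s hs).1.1 _ (hσ t ht).1.1 (hlt.trans hlt') heq
    exact absurd ⟨(hσ u hu1).1.1, hlt, hlt'⟩ (Set.eq_empty_iff_forall_notMem.1 this (σ u))

/-- The running maximum of a continuous function is continuous. -/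
theorem exists_running_sup {h : ℝ → ℝ} (hh : Continuous h) :
    ∃ ψ : ℝ → ℝ, Continuous ψ ∧ ∀ u ∈ Set.Icc (0 : ℝ) 1, IsGreatest (h '' Set.Icc 0 u) (ψ u) := by
  -- Truncating by `min r u` turns the supremum over `[0, u]` into one over the fixed compact set
  -- `[0, 1]`.
  refine ⟨fun u => sSup ((fun r => h (min r u)) '' Set.Icc 0 1),
    isCompact_Icc.continuous_sSup (by fun_prop), fun u hu => ?_⟩
  have himg : (fun r => h (min r u)) '' Set.Icc 0 1 = h '' Set.Icc 0 u := by
    ext y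
    constructor
    · rintro ⟨r, hr, rfl⟩
      exact ⟨min r u, ⟨le_min hr.1 hu.1, min_le_right _ _⟩, rfl⟩
    · rintro ⟨r, hr, rfl⟩
      exact ⟨r, ⟨hr.1, hr.2.trans hu.2⟩, by simp [hr.2]⟩
  change IsGreatest _ (sSup ((fun r => h (min r u)) '' Set.Icc 0 1))
  rw [himg]
  exact (isCompact_Icc.image hh).isGreatest_sSup ⟨_, 0, ⟨le_rfl, hu.1⟩, rfl⟩

/-- A path with order convex fibres factors monotonically through an interval. -/
theorem exists_monotone_of_ordConnected_fibres {X : Type*} [MetricSpace X] {δ : ℝ → X}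
    (hδ : Continuous δ) (hδb : Bornology.IsBounded (Set.range δ))
    (hfib : ∀ s ∈ Set.Icc (0 : ℝ) 1, ∀ t ∈ Set.Icc (0 : ℝ) 1, δ s = δ t →
        ∀ u ∈ Set.Icc s t, δ u = δ s) :
    ∃ φ : ℝ → ℝ, Continuous φ ∧ MonotoneOn φ (Set.Icc 0 1) ∧
      ∀ s ∈ Set.Icc (0 : ℝ) 1, ∀ t ∈ Set.Icc (0 : ℝ) 1, φ s = φ t ↔ δ s = δ t := by
  obtain ⟨D, hD⟩ := Metric.isBounded_iff.1 hδb
  -- The distance from `δ u` to the part of the path traced up to time `q`. Its running maximum is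
  -- monotone and vanishes until `q`; a weighted sum over a dense sequence of `q` gives `φ`.
  let h : ℝ → ℝ → ℝ := fun q u => Metric.infDist (δ u) (δ '' Set.Icc 0 q)
  have hcont : ∀ q, Continuous (h q) := fun q => (Metric.continuous_infDist_pt _).comp hδ
  choose ψ hψ hmax using fun q => exists_running_sup (hcont q)
  have hD0 : 0 ≤ D := dist_nonneg.trans (hD ⟨0, rfl⟩ ⟨0, rfl⟩)
  have hhD : ∀ q u, 0 ≤ h q u ∧ h q u ≤ D := by
    refine fun q u => ⟨Metric.infDist_nonneg, ?_⟩
    by_cases hq : 0 ≤ q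
    · exact (Metric.infDist_le_dist_of_mem (Set.mem_image_of_mem δ (Set.left_mem_Icc.2 hq))).trans (hD ⟨u, rfl⟩ ⟨0, rfl⟩)
    -- For `q < 0` the set is empty and `Metric.infDist` has its default value `0`.
    · simpa [h, Set.Icc_eq_empty hq] using hD0
  have hψD : ∀ q, ∀ u ∈ Set.Icc (0 : ℝ) 1, 0 ≤ ψ q u ∧ ψ q u ≤ D := by
    intro q u hu
    obtain ⟨⟨v, -, hv⟩, -⟩ := hmax q u hu
    rw [← hv]
    exact hhD q v
  have hmono : ∀ q, MonotoneOn (ψ q) (Set.Icc 0 1) := fun q s hs t ht hst =>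
    (hmax q s hs).mono (hmax q t ht) (Set.image_mono (Set.Icc_subset_Icc_right hst))
  have hsep : ∀ s ∈ Set.Icc (0 : ℝ) 1, ∀ t ∈ Set.Icc (0 : ℝ) 1, s < t → δ s ≠ δ t →
      ∃ n, ψ (TopologicalSpace.denseSeq ℝ n) s < ψ (TopologicalSpace.denseSeq ℝ n) t := by
    intro s hs t ht hst hne
    -- With `t'` the first time in `[s, t]` at which the value `δ t` is taken, any `q` in `(s, t')`
    -- separates: convexity of fibres keeps `δ t` off `δ([0, q])`.
    obtain ⟨t', ⟨ht', htt'⟩, hmin⟩ := (isCompact_Icc.inter_right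
      (isClosed_singleton.preimage hδ) : IsCompact (Set.Icc s t ∩ δ ⁻¹' {δ t})).exists_isLeast
      ⟨t, ⟨hst.le, le_rfl⟩, rfl⟩
    have hst' : s < t' := lt_of_le_of_ne ht'.1 fun h => hne (by rw [h]; exact htt')
    obtain ⟨n, hn⟩ := (TopologicalSpace.denseRange_denseSeq ℝ).exists_mem_open isOpen_Ioo
      (Set.nonempty_Ioo.2 hst')
    refine ⟨n, ?_⟩
    set q := TopologicalSpace.denseSeq ℝ n
    have hqt : q < t := hn.2.trans_le ht'.2
    have h1 : ψ q s ≤ 0 := by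
      obtain ⟨⟨v, hv, hve⟩, -⟩ := hmax q s hs
      rw [← hve]
      exact (Metric.infDist_zero_of_mem
        (Set.mem_image_of_mem δ (Set.Icc_subset_Icc_right hn.1.le hv))).le
    have h2 : 0 < h q t := by
      refine ((isCompact_Icc.image hδ).isClosed.notMem_iff_infDist_pos
        ⟨_, 0, ⟨le_rfl, hs.1.trans hn.1.le⟩, rfl⟩).1 ?_
      rintro ⟨v, hv, hve⟩
      have h3 := hfib v ⟨hv.1, hv.2.trans (hqt.le.trans ht.2)⟩ t ht hve q ⟨hv.2, hqt.le⟩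
      exact hn.2.not_ge (hmin ⟨⟨hn.1.le, hqt.le⟩, h3.trans hve⟩)
    exact h1.trans_lt (h2.trans_le ((hmax q t ht).2 ⟨t, ⟨ht.1, le_rfl⟩, rfl⟩))
  have hconst : ∀ q, ∀ s ∈ Set.Icc (0 : ℝ) 1, ∀ t ∈ Set.Icc (0 : ℝ) 1, s ≤ t → δ s = δ t →
      ψ q s = ψ q t := by
    intro q s hs t ht hst heq
    have : h q '' Set.Icc 0 t = h q '' Set.Icc 0 s := by
      refine Set.Subset.antisymm ?_ (Set.image_mono (Set.Icc_subset_Icc_right hst))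
      rintro _ ⟨v, hv, rfl⟩
      rcases le_total v s with hvs | hvs
      · exact ⟨v, ⟨hv.1, hvs⟩, rfl⟩
      · exact ⟨s, ⟨hs.1, le_rfl⟩, by simp only [h]; rw [hfib s hs t ht heq v ⟨hvs, hv.2⟩]⟩
    exact (hmax q s hs).unique (this ▸ hmax q t ht)
  let p : ℝ → ℝ := fun u => (Set.projIcc (0 : ℝ) 1 zero_le_one u : ℝ)
  have hp : ∀ u, p u ∈ Set.Icc (0 : ℝ) 1 := fun u => (Set.projIcc (0 : ℝ) 1 zero_le_one u).2
  have hpe : ∀ u ∈ Set.Icc (0 : ℝ) 1, p u = u := fun u hu => by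
    simp [p, Set.projIcc_of_mem _ hu]
  have hpc : Continuous p := continuous_subtype_val.comp continuous_projIcc
  let a : ℕ → ℝ → ℝ := fun n u => (1 / 2) ^ n * ψ (TopologicalSpace.denseSeq ℝ n) (p u)
  have hsum : Summable fun n : ℕ => (1 / 2 : ℝ) ^ n * D :=
    summable_geometric_two.mul_right D
  have hle : ∀ n u, ‖a n u‖ ≤ (1 / 2 : ℝ) ^ n * D := by
    intro n u
    have := hψD (TopologicalSpace.denseSeq ℝ n) (p u) (hp u)
    rw [Real.norm_of_nonneg (mul_nonneg (by positivity) this.1)]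
    exact mul_le_mul_of_nonneg_left this.2 (by positivity)
  have hsa : ∀ u, Summable fun n => a n u := fun u => Summable.of_norm_bounded hsum (fun n => hle n u)
  have hmono' : ∀ s ∈ Set.Icc (0 : ℝ) 1, ∀ t ∈ Set.Icc (0 : ℝ) 1, s ≤ t → ∀ n, a n s ≤ a n t := by
    intro s hs t ht hst n
    simp only [a, hpe s hs, hpe t ht]
    exact mul_le_mul_of_nonneg_left (hmono _ hs ht hst) (by positivity)
  have hiff : ∀ s ∈ Set.Icc (0 : ℝ) 1, ∀ t ∈ Set.Icc (0 : ℝ) 1, s ≤ t →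
      (∑' n, a n s = ∑' n, a n t ↔ δ s = δ t) := by
    intro s hs t ht hst
    constructor
    · intro heq
      by_contra hne
      have hlt : s < t := lt_of_le_of_ne hst fun h => hne (by rw [h])
      obtain ⟨n, hn⟩ := hsep s hs t ht hlt hne
      refine heq.not_lt (Summable.tsum_lt_tsum (hmono' s hs t ht hst) (i := n) ?_ (hsa s) (hsa t))
      simp only [a, hpe s hs, hpe t ht]
      exact mul_lt_mul_of_pos_left hn (by positivity)
    · intro heq
      congr 1
      funext n
      simp only [a, hpe s hs, hpe t ht, hconst _ s hs t ht hst heq]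
  refine ⟨fun u => ∑' n, a n u, continuous_tsum (fun n => ?_) hsum hle, ?_, ?_⟩
  · exact continuous_const.mul ((hψ _).comp hpc)
  · exact fun s hs t ht hst => (hsa s).tsum_le_tsum (hmono' s hs t ht hst) (hsa t)
  · intro s hs t ht
    rcases le_total s t with h | h
    · exact hiff s hs t ht h
    · rw [eq_comm, hiff t ht s hs h, eq_comm]

/-- The image of a path joining two distinct points contains an arc joining them. -/
theorem exists_arc_of_path {X : Type*} [MetricSpace X] {γ : ℝ → X}
    (hγ : ContinuousOn γ (Set.Icc 0 1)) (hne : γ 0 ≠ γ 1) :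
    ∃ α : ℝ → X, Continuous α ∧ Set.InjOn α (Set.Icc 0 1) ∧ α 0 = γ 0 ∧ α 1 = γ 1 ∧
      α '' Set.Icc 0 1 ⊆ γ '' Set.Icc 0 1 := by
  obtain ⟨δ₀, hδ₀, h0, h1, hsub, hfib₀⟩ := exists_path_ordConnected_fibres hγ
  let p : ℝ → Set.Icc (0 : ℝ) 1 := Set.projIcc (0 : ℝ) 1 zero_le_one
  have hpe : ∀ u (hu : u ∈ Set.Icc (0 : ℝ) 1), p u = ⟨u, hu⟩ := fun u hu => Set.projIcc_of_mem _ hu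
  have hpc : Continuous p := continuous_projIcc
  let δ : ℝ → X := fun u => δ₀ (p u)
  have hδ : Continuous δ := (continuousOn_iff_continuous_domRestrict.1 hδ₀).comp hpc
  have hδe : ∀ u ∈ Set.Icc (0 : ℝ) 1, δ u = δ₀ u := fun u hu => by simp [δ, hpe u hu]
  have hb : Bornology.IsBounded (Set.range δ) := by
    refine (isCompact_Icc.image_of_continuousOn hδ₀).isBounded.subset ?_
    rintro _ ⟨u, rfl⟩
    exact ⟨p u, (p u).2, rfl⟩
  have z0 : (0 : ℝ) ∈ Set.Icc (0 : ℝ) 1 := ⟨le_rfl, zero_le_one⟩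
  have z1 : (1 : ℝ) ∈ Set.Icc (0 : ℝ) 1 := ⟨zero_le_one, le_rfl⟩
  have hfib : ∀ s ∈ Set.Icc (0 : ℝ) 1, ∀ t ∈ Set.Icc (0 : ℝ) 1, δ s = δ t →
      ∀ u ∈ Set.Icc s t, δ u = δ s := by
    intro s hs t ht heq u hu
    rw [hδe s hs, hδe u ⟨hs.1.trans hu.1, hu.2.trans ht.2⟩]
    rw [hδe s hs, hδe t ht] at heq
    exact hfib₀ s hs t ht heq u hu
  obtain ⟨φ, hφ, hmono, hiff⟩ := exists_monotone_of_ordConnected_fibres hδ hb hfib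
  have hlt : φ 0 < φ 1 := by
    refine lt_of_le_of_ne (hmono z0 z1 zero_le_one) fun h => hne ?_
    rw [hiff 0 z0 1 z1, hδe 0 z0, hδe 1 z1, h0, h1] at h
    exact h
  let ψ : ℝ → ℝ := fun u => (φ u - φ 0) / (φ 1 - φ 0)
  have hψ : Continuous ψ := (hφ.sub continuous_const).div_const _
  have hψ0 : ψ 0 = 0 := by simp [ψ]
  have hψ1 : ψ 1 = 1 := div_self (sub_pos.2 hlt).ne'
  have hψm : ∀ u ∈ Set.Icc (0 : ℝ) 1, ψ u ∈ Set.Icc (0 : ℝ) 1 := by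
    intro u hu
    have e1 := hmono z0 hu hu.1
    have e2 := hmono hu z1 hu.2
    exact ⟨div_nonneg (by linarith) (by linarith), (div_le_one (by linarith)).2 (by linarith)⟩
  have hψi : ∀ s ∈ Set.Icc (0 : ℝ) 1, ∀ t ∈ Set.Icc (0 : ℝ) 1, ψ s = ψ t ↔ δ s = δ t := by
    intro s hs t ht
    rw [← hiff s hs t ht, div_left_inj' (sub_pos.2 hlt).ne', sub_left_inj]
  let Ψ : Set.Icc (0 : ℝ) 1 → Set.Icc (0 : ℝ) 1 := fun u => ⟨ψ u, hψm u u.2⟩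
  have hΨ : Continuous Ψ := (hψ.comp continuous_subtype_val).subtype_mk _
  have hsurj : Function.Surjective Ψ := by
    rintro ⟨y, hy⟩
    have := intermediate_value_Icc zero_le_one hψ.continuousOn (a := (0 : ℝ)) (b := 1)
    rw [hψ0, hψ1] at this
    obtain ⟨u, hu, rfl⟩ := this hy
    exact ⟨⟨u, hu⟩, rfl⟩
  -- A continuous surjection from a compact space to a Hausdorff one is a quotient map, so `δ`
  -- descends along `Ψ` to a continuous map, injective because `ψ` and `δ` have the same fibres.
  have hq : IsQuotientMap Ψ := IsQuotientMap.of_surjective_continuous hsurj hΨ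
  choose r hr using hsurj
  have hcomp : ∀ u : Set.Icc (0 : ℝ) 1, δ (r (Ψ u)) = δ u := by
    intro u
    refine (hψi _ (r (Ψ u)).2 _ u.2).1 ?_
    exact congrArg Subtype.val (hr (Ψ u))
  have hα : Continuous fun v => δ (r v) := by
    rw [hq.continuous_iff]
    have : (fun v => δ (r v)) ∘ Ψ = fun u : Set.Icc (0 : ℝ) 1 => δ u := funext hcomp
    rw [this]
    exact hδ.comp continuous_subtype_val
  have hval : ∀ u (hu : u ∈ Set.Icc (0 : ℝ) 1), δ (r (p (ψ u))) = δ u := by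
    intro u hu
    rw [hpe _ (hψm u hu)]
    exact hcomp ⟨u, hu⟩
  refine ⟨fun v => δ (r (p v)), hα.comp hpc, ?_, ?_, ?_, ?_⟩
  · intro u hu v hv huv
    dsimp only at huv
    rw [hpe u hu, hpe v hv] at huv
    have e := (hψi _ (r ⟨u, hu⟩).2 _ (r ⟨v, hv⟩).2).2 huv
    have e1 : ψ (r ⟨u, hu⟩) = u := congrArg Subtype.val (hr ⟨u, hu⟩)
    have e2 : ψ (r ⟨v, hv⟩) = v := congrArg Subtype.val (hr ⟨v, hv⟩)
    rw [e1, e2] at e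
    exact e
  · have := hval 0 z0
    rw [hψ0] at this
    dsimp only
    rw [this, hδe 0 z0, h0]
  · have := hval 1 z1
    rw [hψ1] at this
    dsimp only
    rw [this, hδe 1 z1, h1]
  · rintro _ ⟨v, -, rfl⟩
    exact hsub ⟨r (p v), (r (p v)).2, (hδe _ (r (p v)).2).symm⟩

/-! ### Circles from pairs of arcs. -/

/-- Two arcs with the same endpoints and disjoint interiors form a circle. -/
theorem exists_homeomorph_circle_of_arcs {X : Type*} [MetricSpace X] {α β : ℝ → X}
    (hα : Continuous α) (hβ : Continuous β) (hαi : Set.InjOn α (Set.Icc 0 1))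
    (hβi : Set.InjOn β (Set.Icc 0 1)) (h01 : α 0 = β 1) (h10 : α 1 = β 0)
    (hdisj : ∀ r ∈ Set.Ioo (0 : ℝ) 1, ∀ u ∈ Set.Icc (0 : ℝ) 1, α r ≠ β u) :
    ∃ S : Set X, Nonempty (S ≃ₜ Circle) := by
  -- The closed curve `α` followed by `β`, viewed on the additive circle of length `2`.
  let c : ℝ → X := fun r => if r ≤ 1 then α r else β (r - 1)
  have hc : Continuous c := by
    refine Continuous.if_le hα (hβ.comp (continuous_id.sub continuous_const)) continuous_id
      continuous_const ?_
    rintro r rfl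
    simpa using h10
  have : Fact (0 < (2 : ℝ)) := ⟨two_pos⟩
  have hends : c 0 = c (0 + 2) := by
    norm_num [c, h01]
  have hcirc : Continuous (AddCircle.liftIco 2 0 c) :=
    AddCircle.liftIco_continuous hends hc.continuousOn
  have hmix : ∀ r ∈ Set.Ico (0 : ℝ) 2, ∀ s ∈ Set.Ico (0 : ℝ) 2, r ≤ 1 → ¬ s ≤ 1 →
      α r ≠ β (s - 1) := by
    intro r hr s hs hr1 hs1 heq
    push Not at hs1
    have hs' : s - 1 ∈ Set.Icc (0 : ℝ) 1 := ⟨by linarith, by linarith [hs.2]⟩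
    rcases eq_or_lt_of_le hr.1 with h0 | h0
    · rw [← h0, h01] at heq
      have := hβi (by simp) hs' heq
      linarith [hs.2]
    rcases eq_or_lt_of_le hr1 with h1 | h1
    · rw [h1, h10] at heq
      have := hβi (by simp) hs' heq
      linarith
    · exact hdisj r ⟨h0, h1⟩ _ hs' heq
  have hinj : Set.InjOn c (Set.Ico 0 2) := by
    intro r hr s hs heq
    by_cases hr1 : r ≤ 1 <;> by_cases hs1 : s ≤ 1 <;> simp only [c, hr1, hs1, if_true, if_false] at heq
    · exact hαi ⟨hr.1, hr1⟩ ⟨hs.1, hs1⟩ heq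
    · exact absurd heq (hmix r hr s hs hr1 hs1)
    · exact absurd heq.symm (hmix s hs r hr hs1 hr1)
    · push Not at hr1 hs1
      have := hβi ⟨by linarith, by linarith [hr.2]⟩ ⟨by linarith, by linarith [hs.2]⟩ heq
      linarith
  have hinj' : Function.Injective (AddCircle.liftIco 2 0 c) := by
    intro x y hxy
    obtain ⟨r, hr, rfl⟩ : ∃ r ∈ Set.Ico (0 : ℝ) (0 + 2), (r : AddCircle (2 : ℝ)) = x :=
      ⟨_, (AddCircle.equivIco 2 0 x).2, AddCircle.coe_equivIco⟩
    obtain ⟨s, hs, rfl⟩ : ∃ s ∈ Set.Ico (0 : ℝ) (0 + 2), (s : AddCircle (2 : ℝ)) = y :=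
      ⟨_, (AddCircle.equivIco 2 0 y).2, AddCircle.coe_equivIco⟩
    rw [AddCircle.liftIco_coe_apply hr, AddCircle.liftIco_coe_apply hs] at hxy
    rw [zero_add] at hr hs
    rw [hinj hr hs hxy]
  have hemb : IsEmbedding (AddCircle.liftIco 2 0 c) :=
    (hcirc.isClosedEmbedding hinj').isEmbedding
  exact ⟨_, ⟨hemb.toHomeomorph.symm.trans (AddCircle.homeomorphCircle two_ne_zero)⟩⟩

/-- Two arcs with the same endpoints, one not contained in the other, yield a circle. -/
theorem exists_homeomorph_circle_of_not_subset {X : Type*} [MetricSpace X] {α β : ℝ → X}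
    (hα : Continuous α) (hβ : Continuous β) (hαi : Set.InjOn α (Set.Icc 0 1))
    (hβi : Set.InjOn β (Set.Icc 0 1)) (h0 : α 0 = β 0) (h1 : α 1 = β 1)
    (hsub : ¬ α '' Set.Icc 0 1 ⊆ β '' Set.Icc 0 1) :
    ∃ S : Set X, Nonempty (S ≃ₜ Circle) := by
  obtain ⟨_, ⟨t, ht, rfl⟩, htβ⟩ := Set.not_subset.1 hsub
  have z0 : (0 : ℝ) ∈ Set.Icc (0 : ℝ) 1 := ⟨le_rfl, zero_le_one⟩
  have z1 : (1 : ℝ) ∈ Set.Icc (0 : ℝ) 1 := ⟨zero_le_one, le_rfl⟩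
  have hclosed : IsClosed (α ⁻¹' (β '' Set.Icc 0 1)) :=
    (isCompact_Icc.image hβ).isClosed.preimage hα
  -- The excursion of `α` off `β` around time `t` occupies `(s, s')`. It is closed up by the piece
  -- of `β` from `u'` back to `u`, in whichever order these parameters lie.
  obtain ⟨s, ⟨⟨u, hu, hus⟩, hs⟩, hsmax⟩ := exists_isGreatest_inter_Icc hclosed
    (show (0 : ℝ) ∈ α ⁻¹' (β '' Set.Icc 0 1) from ⟨0, z0, h0.symm⟩) (show _ ∈ Set.Icc 0 t from ⟨le_rfl, ht.1⟩)
  obtain ⟨s', ⟨⟨u', hu', hus'⟩, hs'⟩, hsmin⟩ := exists_isLeast_inter_Icc hclosed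
    (show (1 : ℝ) ∈ α ⁻¹' (β '' Set.Icc 0 1) from ⟨1, z1, h1.symm⟩) (show _ ∈ Set.Icc t 1 from ⟨ht.2, le_rfl⟩)
  have hst : s < t := lt_of_le_of_ne hs.2 fun h => htβ ⟨u, hu, by rw [hus, h]⟩
  have hts : t < s' := lt_of_le_of_ne hs'.1 fun h => htβ ⟨u', hu', by rw [hus', h]⟩
  have hss : s < s' := hst.trans hts
  have huu : u ≠ u' := fun h => hss.ne (hαi ⟨hs.1, hs.2.trans ht.2⟩ ⟨ht.1.trans hs'.1, hs'.2⟩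
    (by rw [← hus, ← hus', h]))
  have hA : ∀ r ∈ Set.Icc (0 : ℝ) 1, s + (s' - s) * r ∈ Set.Icc s s' := fun r hr =>
    ⟨by nlinarith [hr.1], by nlinarith [hr.2]⟩
  have hB : ∀ r ∈ Set.Icc (0 : ℝ) 1, u' + (u - u') * r ∈ Set.Icc (0 : ℝ) 1 := fun r hr =>
    ⟨by nlinarith [hr.1, hr.2, hu.1, hu'.1], by nlinarith [hr.1, hr.2, hu.2, hu'.2]⟩
  refine exists_homeomorph_circle_of_arcs (α := fun r => α (s + (s' - s) * r))
    (β := fun r => β (u' + (u - u') * r)) (by fun_prop) (by fun_prop) ?_ ?_ ?_ ?_ ?_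
  · intro r hr r' hr' heq
    have e1 := hA r hr
    have e2 := hA r' hr'
    have := hαi ⟨hs.1.trans e1.1, e1.2.trans hs'.2⟩ ⟨hs.1.trans e2.1, e2.2.trans hs'.2⟩ heq
    exact mul_left_cancel₀ (sub_pos.2 hss).ne' (add_left_cancel this)
  · intro r hr r' hr' heq
    exact mul_left_cancel₀ (sub_ne_zero.2 huu) (add_left_cancel (hβi (hB r hr) (hB r' hr') heq))
  · simp [hus]
  · simp [hus']
  · intro r hr v hv heq
    have e1 : s < s + (s' - s) * r := by nlinarith [hr.1]
    have e2 : s + (s' - s) * r < s' := by nlinarith [hr.2]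
    have hmem : s + (s' - s) * r ∈ α ⁻¹' (β '' Set.Icc 0 1) := ⟨_, hB v hv, heq.symm⟩
    rcases le_total (s + (s' - s) * r) t with h | h
    · exact e1.not_ge (hsmax ⟨hmem, hs.1.trans e1.le, h⟩)
    · exact e2.not_ge (hsmin ⟨hmem, h, e2.le.trans hs'.2⟩)

/-! ### Hulls and betweenness in a dendrite. -/

/-- The smallest closed set that lies in all closed connected sets containing `a` and `b`. -/
def continuumHull {X : Type*} [TopologicalSpace X] (a b : X) : Set X :=
  ⋂₀ {K | IsClosed K ∧ IsPreconnected K ∧ a ∈ K ∧ b ∈ K}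

section Hull

variable {X : Type*} [TopologicalSpace X] {a b : X}

theorem left_mem_continuumHull : a ∈ continuumHull a b := fun _ hK => hK.2.2.1

theorem right_mem_continuumHull : b ∈ continuumHull a b := fun _ hK => hK.2.2.2

theorem isClosed_continuumHull : IsClosed (continuumHull a b) :=
  isClosed_sInter fun _ hK => hK.1

theorem continuumHull_subset {K : Set X} (h1 : IsClosed K) (h2 : IsPreconnected K) (ha : a ∈ K)
    (hb : b ∈ K) : continuumHull a b ⊆ K :=
  Set.sInter_subset_of_mem ⟨h1, h2, ha, hb⟩

theorem continuumHull_comm : continuumHull a b = continuumHull b a := by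
  simp only [continuumHull, and_comm]

end Hull

/-- In a dendrite the hull of two points is an arc. -/
theorem IsDendrite.exists_arc {X : Type*} [MetricSpace X] (hX : IsDendrite X) {a b : X}
    (hab : a ≠ b) : ∃ α : ℝ → X, Continuous α ∧ Set.InjOn α (Set.Icc 0 1) ∧ α 0 = a ∧ α 1 = b ∧
      continuumHull a b = α '' Set.Icc 0 1 := by
  have := hX.continuum.compact
  have := hX.continuum.connected
  have := hX.locallyConnected
  have : LocallyPathConnectedSpace X := locallyPathConnectedSpace_of_complete
  have key : ∀ U : Set X, IsOpen U → IsPreconnected U → a ∈ U → b ∈ U →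
      ∃ α : ℝ → X, Continuous α ∧ Set.InjOn α (Set.Icc 0 1) ∧ α 0 = a ∧ α 1 = b ∧
        α '' Set.Icc 0 1 ⊆ U := by
    intro U hU hUc ha hb
    obtain ⟨γ, hγ⟩ := (hU.isConnected_iff_isPathConnected.1 ⟨⟨a, ha⟩, hUc⟩).joinedIn a ha b hb
    obtain ⟨α, h1, h2, h3, h4, h5⟩ := exists_arc_of_path (γ := γ.extend)
      γ.continuous_extend.continuousOn (by simpa using hab)
    refine ⟨α, h1, h2, by simpa using h3, by simpa using h4, h5.trans ?_⟩
    rintro _ ⟨t, ht, rfl⟩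
    rw [γ.extend_apply ht]
    exact hγ _
  obtain ⟨α, hα, hαi, h0, h1, -⟩ := key Set.univ isOpen_univ isPreconnected_univ trivial trivial
  refine ⟨α, hα, hαi, h0, h1, Set.Subset.antisymm ?_ ?_⟩
  · exact continuumHull_subset (isCompact_Icc.image hα).isClosed
      (isPreconnected_Icc.image α hα.continuousOn) ⟨0, by simp, h0⟩ ⟨1, by simp, h1⟩
  -- If `K` missed `p`, then `a` and `b` would lie in one component of the complement of `p`, hence
  -- be joined by an arc avoiding `p`; together with `α` it would yield a circle.
  · rintro p hp K ⟨hK, hKc, ha, hb⟩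
    by_contra hpK
    have hKp : K ⊆ {p}ᶜ := fun x hx hxp => hpK (hxp ▸ hx)
    obtain ⟨β, hβ, hβi, h0', h1', hβU⟩ := key (connectedComponentIn {p}ᶜ a)
      isOpen_compl_singleton.connectedComponentIn isPreconnected_connectedComponentIn
      (mem_connectedComponentIn (hKp ha)) (hKc.subset_connectedComponentIn ha hKp hb)
    obtain ⟨S, hS⟩ := exists_homeomorph_circle_of_not_subset hα hβ hαi hβi (h0.trans h0'.symm)
      (h1.trans h1'.symm) fun h => connectedComponentIn_subset _ _ (hβU (h hp)) rfl
    exact hX.no_simple_closed_curve S hS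

theorem continuumHull_self {X : Type*} [TopologicalSpace X] [T1Space X] {a : X} :
    continuumHull a a = {a} :=
  Set.Subset.antisymm (continuumHull_subset isClosed_singleton isPreconnected_singleton rfl rfl)
    (Set.singleton_subset_iff.2 left_mem_continuumHull)

theorem IsDendrite.isPreconnected_continuumHull {X : Type*} [MetricSpace X] (hX : IsDendrite X)
    (a b : X) : IsPreconnected (continuumHull a b) := by
  by_cases hab : a = b
  · rw [hab, continuumHull_self]
    exact isPreconnected_singleton
  · obtain ⟨α, hα, -, -, -, h⟩ := hX.exists_arc hab
    rw [h]
    exact isPreconnected_Icc.image α hα.continuousOn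

theorem IsDendrite.continuumHull_subset_union {X : Type*} [MetricSpace X] (hX : IsDendrite X)
    (a b c : X) : continuumHull a b ⊆ continuumHull a c ∪ continuumHull c b :=
  continuumHull_subset (isClosed_continuumHull.union isClosed_continuumHull)
    ((hX.isPreconnected_continuumHull a c).union c right_mem_continuumHull left_mem_continuumHull
      (hX.isPreconnected_continuumHull c b))
    (Or.inl left_mem_continuumHull) (Or.inr right_mem_continuumHull)

theorem IsDendrite.continuumHull_subset_left {X : Type*} [MetricSpace X] (hX : IsDendrite X)
    {a b y : X} (hy : y ∈ continuumHull a b) : continuumHull a y ⊆ continuumHull a b :=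
  continuumHull_subset isClosed_continuumHull (hX.isPreconnected_continuumHull a b)
    left_mem_continuumHull hy

theorem IsDendrite.continuumHull_subset_right {X : Type*} [MetricSpace X] (hX : IsDendrite X)
    {a b y : X} (hy : y ∈ continuumHull a b) : continuumHull y b ⊆ continuumHull a b :=
  continuumHull_subset isClosed_continuumHull (hX.isPreconnected_continuumHull a b)
    hy right_mem_continuumHull

/-- On the arc from `c` to `z`, the hull of `c` and `α t` stays in `α([0, t])`, which reaches the
end `z` only if `t = 1`. -/
theorem IsDendrite.continuumHull_antisymm {X : Type*} [MetricSpace X] (hX : IsDendrite X)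
    {c y z : X} (hy : y ∈ continuumHull c z) (hz : z ∈ continuumHull c y) : y = z := by
  by_cases hcz : c = z
  · rw [← hcz, continuumHull_self] at hy
    exact hy.trans hcz
  obtain ⟨α, hα, hαi, h0, h1, h⟩ := hX.exists_arc hcz
  rw [h] at hy
  obtain ⟨t, ht, rfl⟩ := hy
  have hsub : continuumHull c (α t) ⊆ α '' Set.Icc 0 t :=
    continuumHull_subset (isCompact_Icc.image hα).isClosed
      (isPreconnected_Icc.image α hα.continuousOn) ⟨0, ⟨le_rfl, ht.1⟩, h0⟩ ⟨t, ⟨ht.1, le_rfl⟩, rfl⟩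
  obtain ⟨s, hs, hsz⟩ := hsub hz
  have h2 : s = 1 := hαi ⟨hs.1, hs.2.trans ht.2⟩ (by simp) (hsz.trans h1.symm)
  have h3 : t = 1 := le_antisymm ht.2 (h2 ▸ hs.2)
  rw [h3, h1]

/-- Hulls of nearby points are small. -/
theorem eventually_continuumHull_subset {X : Type*} [MetricSpace X] [LocallyConnectedSpace X]
    {p : X} {V : Set X} (hV : V ∈ 𝓝 p) : ∀ᶠ q in 𝓝 p, continuumHull p q ⊆ V := by
  obtain ⟨K, hK, hKc, hKV⟩ := exists_mem_nhds_isClosed_subset hV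
  obtain ⟨W, hW, ho, hc, hp⟩ := exists_open_preconnected_subset hK
  filter_upwards [ho.mem_nhds hp] with q hq
  exact (continuumHull_subset isClosed_closure hc.closure (subset_closure hp)
    (subset_closure hq)).trans ((closure_minimal hW hKc).trans hKV)

/-- Betweenness relative to a base point is a closed relation. -/
theorem IsDendrite.isClosed_setOf_mem_continuumHull {X : Type*} [MetricSpace X]
    (hX : IsDendrite X) (c : X) : IsClosed {p : X × X | p.1 ∈ continuumHull c p.2} := by
  have := hX.locallyConnected
  rw [← isOpen_compl_iff, isOpen_iff_mem_nhds]
  rintro ⟨y, z⟩ hyz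
  have hyz : y ∉ continuumHull c z := hyz
  have hne : y ≠ z := fun h => hyz (h ▸ right_mem_continuumHull)
  obtain ⟨U, V, hU, hV, hyU, hzV, hUV⟩ := t2_separation hne
  have e1 : ∀ᶠ y' in 𝓝 y, y' ∈ U ∧ y' ∉ continuumHull c z := by
    filter_upwards [hU.mem_nhds hyU, isClosed_continuumHull.isOpen_compl.mem_nhds hyz]
      with y' h1 h2 using ⟨h1, h2⟩
  have e2 := eventually_continuumHull_subset (hV.mem_nhds hzV)
  rw [nhds_prod_eq]
  filter_upwards [e1.prod_mk e2] with q hq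
  intro hmem
  -- Moving `z` slightly changes the hull only inside `V`, which is disjoint from the neighbourhood
  -- `U` of `y`.
  rcases hX.continuumHull_subset_union c q.2 z hmem with h | h
  · exact hq.1.2 h
  · exact Set.disjoint_left.1 hUV hq.1.1 (hq.2 h)

/-! ### Extremal points for the betweenness order. -/

/-- In a nonempty compact set, a partial order with closed upper sections has a maximal
element. -/
theorem IsCompact.exists_maximal_of_isClosed {X : Type*} [TopologicalSpace X]
    {A : Set X} (hA : IsCompact A) (hAc : IsClosed A) (hne : A.Nonempty) {r : X → X → Prop}
    (hrefl : ∀ x, r x x) (htrans : ∀ {x y z}, r x y → r y z → r x z)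
    (hcl : ∀ x, IsClosed {y | r x y}) : ∃ m ∈ A, ∀ z ∈ A, r m z → r z m := by
  let s : A → A → Prop := fun x y => r x y
  obtain ⟨m, hm⟩ := exists_maximal_of_chains_bounded (r := s) (fun c hc => by
    rcases c.eq_empty_or_nonempty with rfl | hcne
    · exact ⟨⟨_, hne.some_mem⟩, by simp⟩
    have := hcne.to_subtype
    have : (⋂ x : c, A ∩ {y | r x y}).Nonempty := by
      refine IsCompact.nonempty_iInter_of_directed_nonempty_isCompact_isClosed _ ?_
        (fun x => ⟨x, x.1.2, hrefl _⟩) (fun x => hA.inter_right (hcl _))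
        (fun x => hAc.inter (hcl _))
      intro x y
      rcases eq_or_ne x.1 y.1 with h | h
      · exact ⟨x, subset_rfl, by rw [Subtype.ext h]⟩
      rcases hc x.2 y.2 h with h | h
      · exact ⟨y, fun z hz => ⟨hz.1, htrans h hz.2⟩, subset_rfl⟩
      · exact ⟨x, subset_rfl, fun z hz => ⟨hz.1, htrans h hz.2⟩⟩
    obtain ⟨u, hu⟩ := this
    rw [Set.mem_iInter] at hu
    exact ⟨⟨u, (hu ⟨_, hcne.some_mem⟩).1⟩, fun a ha => (hu ⟨a, ha⟩).2⟩) htrans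
  exact ⟨m, m.2, fun z hz h => hm ⟨z, hz⟩ h⟩

section Dendrite

variable {X : Type*} [MetricSpace X]

theorem IsDendrite.exists_maximal (hX : IsDendrite X) (c : X) {A : Set X} (hA : IsClosed A)
    (hne : A.Nonempty) : ∃ m ∈ A, ∀ z ∈ A, m ∈ continuumHull c z → z = m := by
  have := hX.continuum.compact
  obtain ⟨m, hm, h⟩ := hA.isCompact.exists_maximal_of_isClosed hA hne
    (r := fun x y => x ∈ continuumHull c y) (fun x => right_mem_continuumHull)
    (fun hxy hyz => hX.continuumHull_subset_left hyz hxy)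
    (fun x => (hX.isClosed_setOf_mem_continuumHull c).preimage (Continuous.prodMk_right x))
  exact ⟨m, hm, fun z hz hmz => hX.continuumHull_antisymm (h z hz hmz) hmz⟩

theorem IsDendrite.exists_minimal (hX : IsDendrite X) (c : X) {A : Set X} (hA : IsClosed A)
    (hne : A.Nonempty) : ∃ m ∈ A, ∀ z ∈ A, z ∈ continuumHull c m → z = m := by
  have := hX.continuum.compact
  obtain ⟨m, hm, h⟩ := hA.isCompact.exists_maximal_of_isClosed hA hne
    (r := fun x y => y ∈ continuumHull c x) (fun x => right_mem_continuumHull)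
    (fun hxy hyz => hX.continuumHull_subset_left hxy hyz) (fun x => isClosed_continuumHull)
  exact ⟨m, hm, fun z hz hzm => hX.continuumHull_antisymm hzm (h z hz hzm)⟩

/-! ### Fixed points of maps of a dendrite. -/

/-- Near a point moved by `f`, betweenness relative to the images of nearby points agrees. -/
theorem IsDendrite.eventually_mem_continuumHull_iff (hX : IsDendrite X) {f : X → X}
    (hf : Continuous f) (c : X) {y : X} (hy : f y ≠ y) :
    ∀ᶠ v in 𝓝 y, v ∈ continuumHull c (f v) ↔ v ∈ continuumHull c (f y) := by
  have := hX.locallyConnected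
  obtain ⟨U, V, hU, hV, hyU, hyV, hUV⟩ := t2_separation hy
  filter_upwards [hf.continuousAt.eventually (eventually_continuumHull_subset (hU.mem_nhds hyU)),
    hV.mem_nhds hyV] with v h1 h2
  have h3 : v ∉ continuumHull (f y) (f v) := fun h => Set.disjoint_left.1 hUV (h1 h) h2
  constructor <;> intro h
  · exact (hX.continuumHull_subset_union c (f v) (f y) h).resolve_right h3
  · refine (hX.continuumHull_subset_union c (f y) (f v) h).resolve_right ?_
    rwa [continuumHull_comm]

/-- A nontrivial connected set has no isolated points; this supplies the small pushes along an arc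
that contradict extremality. -/
theorem IsDendrite.frequently_mem_continuumHull (hX : IsDendrite X) {y z w : X}
    (hy : y ∈ continuumHull z w) (hne : z ≠ w) :
    ∃ᶠ v in 𝓝 y, v ∈ continuumHull z w ∧ v ≠ y := by
  rw [frequently_iff]
  intro U hU
  obtain ⟨v, hv, hvy⟩ := preperfect_iff_nhds.1 ((hX.isPreconnected_continuumHull z w
    ).preperfect_of_nontrivial ⟨z, left_mem_continuumHull, w, right_mem_continuumHull, hne⟩) y hy U hU
  exact ⟨v, hv.1, hv.2, hvy⟩

/-- Dendrites have the fixed point property. -/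
theorem IsDendrite.exists_fixedPoint (hX : IsDendrite X) {f : X → X} (hf : Continuous f) :
    ∃ x, f x = x := by
  have := hX.continuum.connected
  obtain ⟨c⟩ : Nonempty X := inferInstance
  have hA : IsClosed {y | y ∈ continuumHull c (f y)} :=
    (hX.isClosed_setOf_mem_continuumHull c).preimage (continuous_id.prodMk hf)
  obtain ⟨y, hy, hmax⟩ := hX.exists_maximal c hA ⟨c, left_mem_continuumHull⟩
  have hy : y ∈ continuumHull c (f y) := hy
  refine ⟨y, by_contra fun hne => ?_⟩
  -- A point `v ≠ y` of the hull of `y` and `f y`, close to `y`, still satisfies the defining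
  -- condition and lies beyond `y` as seen from `c`.
  obtain ⟨v, ⟨hv, hvy⟩, hiff⟩ := ((hX.frequently_mem_continuumHull left_mem_continuumHull
    (Ne.symm hne)).and_eventually (hX.eventually_mem_continuumHull_iff hf c hne)).exists
  refine hvy (hmax v (hiff.2 (hX.continuumHull_subset_right hy hv)) ?_)
  refine (hX.continuumHull_subset_union c (f y) v hy).resolve_right fun h => hvy ?_
  rw [continuumHull_comm] at h hv
  exact hX.continuumHull_antisymm hv h

/-- A point not moved towards a fixed point is fixed, if the fixed points have small invariant
connected neighbourhoods. -/
theorem IsDendrite.eq_of_mem_continuumHull (hX : IsDendrite X) {f : X → X} (hf : Continuous f)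
    (hstable : ∀ c, f c = c → ∀ V ∈ 𝓝 c, ∃ K ∈ 𝓝 c, K ⊆ V ∧ IsClosed K ∧ IsPreconnected K ∧
      Set.MapsTo f K K) {c₀ x : X} (hc₀ : f c₀ = c₀) (hx : x ∈ continuumHull c₀ (f x)) :
    f x = x := by
  by_contra hne
  have hfix : IsClosed {y | f y = y} := isClosed_eq hf continuous_id
  -- The base is moved to the fixed point `c` between `c₀` and `x` that is nearest to `x` in the
  -- order, so no other fixed point lies between `c` and `x`.
  obtain ⟨c, ⟨hc, hcx⟩, hcmin⟩ := hX.exists_minimal x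
    (hfix.inter (isClosed_continuumHull (a := c₀) (b := x)))
    ⟨c₀, hc₀, left_mem_continuumHull⟩
  have hc : f c = c := hc
  have hxc : x ≠ c := fun h => hne (by rw [h, hc])
  have hxf : x ∈ continuumHull c (f x) :=
    (hX.continuumHull_subset_union c₀ (f x) c hx).resolve_left fun h =>
      hxc (hX.continuumHull_antisymm h hcx)
  obtain ⟨K, hKc, hKx, hK, hKp, hKf⟩ := hstable c hc {x}ᶜ (isOpen_compl_singleton.mem_nhds hxc.symm)
  have hcK : c ∈ K := mem_of_mem_nhds hKc
  let D : Set X := {y | y ∈ continuumHull c x ∧ y ∈ continuumHull c (f y) ∧ y ∉ K}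
  have hxD : x ∈ D := ⟨right_mem_continuumHull, hxf, fun h => hKx h rfl⟩
  obtain ⟨y, hy, hymin⟩ := hX.exists_minimal c (isClosed_closure (s := D)) ⟨x, subset_closure hxD⟩
  have hclosed : IsClosed {y | y ∈ continuumHull c (f y)} :=
    (hX.isClosed_setOf_mem_continuumHull c).preimage (continuous_id.prodMk hf)
  have hyx : y ∈ continuumHull c x := closure_minimal (fun z hz => hz.1) isClosed_continuumHull hy
  have hyf : y ∈ continuumHull c (f y) := closure_minimal (fun z hz => hz.2.1) hclosed hy
  have hfreq : ∃ᶠ v in 𝓝 y, v ∈ D := mem_closure_iff_frequently.1 hy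
  have hyc : y ≠ c := by
    rintro rfl
    obtain ⟨v, hv, hvK⟩ := (hfreq.and_eventually hKc).exists
    exact hv.2.2 hvK
  have hmoved : f y ≠ y := fun h => hyc <| hcmin y
    ⟨h, hX.continuumHull_subset_right hcx hyx⟩ (by rwa [continuumHull_comm])
  have hiff := hX.eventually_mem_continuumHull_iff hf c hmoved
  -- If `y ∈ K`, invariance puts the whole hull of `c` and `f y` in `K`, yet it contains points of
  -- `D`, which avoid `K`. Otherwise `y` can be pushed towards `c` within `D`, against minimality.
  by_cases hyK : y ∈ K
  · obtain ⟨v, hv, hviff⟩ := (hfreq.and_eventually hiff).exists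
    exact hv.2.2 (continuumHull_subset hK hKp hcK (hKf hyK) (hviff.1 hv.2.1))
  · obtain ⟨v, ⟨hv, hvy⟩, hviff, hvK⟩ := ((hX.frequently_mem_continuumHull
      (right_mem_continuumHull (a := c)) hyc.symm).and_eventually
      (hiff.and (hK.isOpen_compl.mem_nhds hyK))).exists
    exact hvy (hymin v (subset_closure ⟨hX.continuumHull_subset_left hyx hv,
      hviff.2 (hX.continuumHull_subset_left hyf hv), hvK⟩) hv)

theorem IsDendrite.isConnected_fixedPoints (hX : IsDendrite X) {f : X → X} (hf : Continuous f)
    (hstable : ∀ c, f c = c → ∀ V ∈ 𝓝 c, ∃ K ∈ 𝓝 c, K ⊆ V ∧ IsClosed K ∧ IsPreconnected K ∧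
      Set.MapsTo f K K) : IsConnected (Function.fixedPoints f) := by
  refine ⟨hX.exists_fixedPoint hf, isPreconnected_of_forall_pair fun a ha b hb =>
    ⟨continuumHull a b, fun x hx => ?_, left_mem_continuumHull, right_mem_continuumHull,
      hX.isPreconnected_continuumHull a b⟩⟩
  rcases hX.continuumHull_subset_union a b (f x) hx with h | h
  · exact hX.eq_of_mem_continuumHull hf hstable ha h
  · rw [continuumHull_comm] at h
    exact hX.eq_of_mem_continuumHull hf hstable hb h

end Dendrite

/-! ### Stability of periodic points. -/

/-- A closed set missing the orbit of a periodic point `p` with `ω(p, f) = Ω(p, f)` is missed by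
the orbits of all points near `p`. -/
theorem exists_nhds_iterate_notMem {X : Type*} [MetricSpace X] [CompactSpace X] {f : X → X}
    (hf : Continuous f) {p : X} {m : ℕ} (hm : 0 < m) (hp : f^[m] p = p)
    (hω : omegaSet p f = bigOmegaSet p f) {C : Set X} (hC : IsClosed C)
    (hdisj : ∀ n, f^[n] p ∉ C) : ∃ U ∈ 𝓝 p, ∀ x ∈ U, ∀ n, f^[n] x ∉ C := by
  by_contra! hcon
  -- In these neighbourhoods the iterates up to `k` avoid `C`, so the hitting times `n k` exceed `k`
  -- and a subsequence of them is strictly increasing.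
  have hU : ∀ k : ℕ, Metric.ball p (1 / (k + 1)) ∩ ⋂ j ∈ Set.Iic k, f^[j] ⁻¹' Cᶜ ∈ 𝓝 p := by
    intro k
    refine inter_mem (Metric.ball_mem_nhds p (by positivity))
      ((biInter_mem (Set.finite_Iic k)).2 fun j _ => ?_)
    exact (hf.iterate j).continuousAt.preimage_mem_nhds (hC.isOpen_compl.mem_nhds (hdisj j))
  choose u hu n hn using fun k => hcon _ (hU k)
  have hun : ∀ k, k < n k := by
    intro k
    by_contra! h
    have := (hu k).2
    rw [Set.mem_iInter₂] at this
    exact this (n k) h (hn k)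
  have hup : Tendsto u atTop (𝓝 p) := by
    rw [tendsto_iff_dist_tendsto_zero]
    exact squeeze_zero (fun _ => dist_nonneg) (fun k => (hu k).1.le)
      tendsto_one_div_add_atTop_nhds_zero_nat
  obtain ⟨φ, hφ, hnφ⟩ := strictMono_subseq_of_tendsto_atTop
    (tendsto_atTop_mono (fun k => (hun k).le) tendsto_id)
  obtain ⟨y, θ, hθ, hy⟩ := CompactSpace.tendsto_subseq fun k => f^[n (φ k)] (u (φ k))
  have hyC : y ∈ C := hC.mem_of_tendsto hy (Eventually.of_forall fun k => hn _)
  have hyΩ : y ∈ bigOmegaSet p f := ⟨u ∘ φ ∘ θ, n ∘ φ ∘ θ,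
    hup.comp (hφ.tendsto_atTop.comp hθ.tendsto_atTop), hnφ.comp hθ, hy⟩
  rw [← hω] at hyΩ
  obtain ⟨l, -, hl⟩ := hyΩ
  let O : Set X := (fun n => f^[n] p) '' Set.Iio m
  have hO : IsClosed O := ((Set.finite_Iio m).image _).isClosed
  obtain ⟨j, -, hj⟩ : y ∈ O := by
    refine hO.mem_of_tendsto hl (Eventually.of_forall fun i => ⟨l i % m, Nat.mod_lt _ hm, ?_⟩)
    exact Function.IsPeriodicPt.iterate_mod_apply hp _
  rw [← hj] at hyC
  exact hdisj j hyC

/-- Periodic points `p` with `ω(p, f) = Ω(p, f)` are Lyapunov stable for the iterate fixing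
them. -/
theorem exists_nhds_iterate_mem {X : Type*} [MetricSpace X] [CompactSpace X]
    [LocallyConnectedSpace X] {f : X → X}
    (hf : Continuous f) {p : X} {m : ℕ} (hm : 0 < m) (hp : f^[m] p = p)
    (hω : omegaSet p f = bigOmegaSet p f) {V : Set X} (hV : V ∈ 𝓝 p) :
    ∃ U ∈ 𝓝 p, IsPreconnected U ∧ ∀ x ∈ U, ∀ n, (f^[m])^[n] x ∈ V := by
  obtain ⟨ε, hε, hεV⟩ := Metric.mem_nhds_iff.1 hV
  let O : Set X := (fun n => f^[n] p) '' Set.Iio m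
  have hO : (O \ {p}).Finite := ((Set.finite_Iio m).image _).subset Set.sdiff_subset
  -- The radius is below `ε` and below the distance from `p` to the rest of its finite orbit, so the
  -- sphere of radius `r` misses the orbit.
  obtain ⟨r, hr, hrε, hrO⟩ : ∃ r > 0, r < ε ∧ ∀ q ∈ O \ {p}, r < dist q p := by
    have h1 : ∀ᶠ r in 𝓝[>] (0 : ℝ), ∀ q ∈ O \ {p}, r < dist q p :=
      (Set.Finite.eventually_all hO).2 fun q hq => by
        filter_upwards [Ioo_mem_nhdsGT (dist_pos.2 hq.2)] with r hr using hr.2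
    obtain ⟨r, h, hr⟩ := (h1.and (Ioo_mem_nhdsGT hε)).exists
    exact ⟨r, hr.1, hr.2, h⟩
  have hdisj : ∀ n, f^[n] p ∉ Metric.sphere p r := by
    intro n hn
    rw [Metric.mem_sphere] at hn
    have hmem : f^[n] p ∈ O \ {p} := by
      refine ⟨⟨n % m, Nat.mod_lt _ hm, Function.IsPeriodicPt.iterate_mod_apply hp n⟩, fun h => ?_⟩
      rw [Set.mem_singleton_iff.1 h, dist_self] at hn
      exact hr.ne hn
    exact (hrO _ hmem).ne' hn
  obtain ⟨U, hU, hUn⟩ := exists_nhds_iterate_notMem hf hm hp hω Metric.isClosed_sphere hdisj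
  obtain ⟨W, hWU, hWo, hWc, hpW⟩ := exists_open_preconnected_subset hU
  refine ⟨W, hWo.mem_nhds hpW, hWc, fun x hx n => hεV ?_⟩
  have hfix : (f^[m])^[n] p = p := Function.iterate_fixed hp n
  have hconn : IsPreconnected ((fun y => dist ((f^[m])^[n] y) p) '' W) :=
    hWc.image _ (((hf.iterate m).iterate n).dist continuous_const).continuousOn
  -- An iterate leaving the ball would, by connectedness of `W`, force some point of `W` to land on
  -- the sphere at the same time.
  by_contra hfar
  rw [Metric.mem_ball, not_lt] at hfar
  obtain ⟨y, hy, hyr⟩ := hconn.ordConnected.out ⟨p, hpW, rfl⟩ ⟨x, hx, rfl⟩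
    (show r ∈ Set.Icc _ _ from ⟨by simpa [hfix] using hr.le, hrε.le.trans hfar⟩)
  refine hUn y (hWU hy) (m * n) ?_
  rw [Function.iterate_mul]
  exact hyr

/-- The forward images of a connected neighbourhood all contain `c`, so the closure of their union
is connected and invariant; stability keeps it inside `V`. -/
theorem exists_invariant_nhds {X : Type*} [MetricSpace X] {g : X → X} (hg : Continuous g)
    {c : X} (hc : g c = c) (hstable : ∀ V ∈ 𝓝 c, ∃ U ∈ 𝓝 c, IsPreconnected U ∧
      ∀ x ∈ U, ∀ n, g^[n] x ∈ V) {V : Set X} (hV : V ∈ 𝓝 c) :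
    ∃ K ∈ 𝓝 c, K ⊆ V ∧ IsClosed K ∧ IsPreconnected K ∧ Set.MapsTo g K K := by
  obtain ⟨W, hW, hWc, hWV⟩ := exists_mem_nhds_isClosed_subset hV
  obtain ⟨U, hU, hUc, hUW⟩ := hstable W hW
  have hmaps : Set.MapsTo g (⋃ n, g^[n] '' U) (⋃ n, g^[n] '' U) := by
    rintro x hx
    obtain ⟨n, y, hy, rfl⟩ := Set.mem_iUnion.1 hx
    exact Set.mem_iUnion.2 ⟨n + 1, y, hy, Function.iterate_succ_apply' g n y⟩
  refine ⟨closure (⋃ n, g^[n] '' U), ?_, ?_, isClosed_closure, ?_, hmaps.closure hg⟩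
  · refine mem_of_superset hU (Set.Subset.trans ?_ subset_closure)
    exact fun x hx => Set.mem_iUnion.2 ⟨0, x, hx, rfl⟩
  · refine (closure_minimal ?_ hWc).trans hWV
    refine Set.iUnion_subset fun n => ?_
    rintro _ ⟨x, hx, rfl⟩
    exact hUW x hx n
  · refine IsPreconnected.closure (isPreconnected_iUnion ⟨c, ?_⟩ fun n =>
      hUc.image _ (hg.iterate n).continuousOn)
    exact Set.mem_iInter.2 fun n => ⟨c, mem_of_mem_nhds hU, Function.iterate_fixed hc n⟩

theorem mainTheorem7 {X : Type*} [MetricSpace X] (hX : IsDendrite X)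
    (f : X → X) (hf : Continuous f)
    (hω : ∀ x : X, omegaSet x f = bigOmegaSet x f) :
    (∀ m : ℕ, 1 ≤ m → IsConnected (Function.fixedPoints f^[m])) ∧
      IsConnected (Function.periodicPts f) := by
  have := hX.continuum.compact
  have := hX.locallyConnected
  have hfix : ∀ m : ℕ, 1 ≤ m → IsConnected (Function.fixedPoints f^[m]) := fun m hm =>
    hX.isConnected_fixedPoints (hf.iterate m) fun c hc _ hV =>
      exists_invariant_nhds (hf.iterate m) hc
        (fun _ hV => exists_nhds_iterate_mem hf hm hc (hω c) hV) hV
  refine ⟨hfix, ?_⟩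
  have hper : Function.periodicPts f = ⋃ m : {m : ℕ // 1 ≤ m}, Function.fixedPoints f^[m] := by
    ext x
    simp only [Set.mem_iUnion, Subtype.exists]
    exact ⟨fun ⟨m, hm, h⟩ => ⟨m, hm, h⟩, fun ⟨m, hm, h⟩ => ⟨m, hm, h⟩⟩
  obtain ⟨c, hc⟩ := hX.exists_fixedPoint hf
  have hmem : ∀ m, c ∈ Function.fixedPoints f^[m] := fun m => Function.iterate_fixed hc m
  rw [hper]
  exact ⟨⟨c, Set.mem_iUnion.2 ⟨⟨1, le_rfl⟩, hmem 1⟩⟩, isPreconnected_iUnion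
    ⟨c, Set.mem_iInter.2 fun m => hmem m⟩ fun m => (hfix m m.2).isPreconnected⟩
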